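/- **Language.** Fix a denumerable set of variables $x$ and a denumerable set of atoms $'a$, among them two distinct atoms $'true,'false$, and any choice of binary operations $\otimes:\mathbb Z^2\to\mathbb Z$ and of binary relations $\bowtie$ on $\mathbb Z$. Patterns are $p ::= x \mid {'a} \mid (p,q)$, each variable occurring at most once in $p$. Terms, up to renaming of bound variables, are $$M ::= x \mid {'a} \mid \underline n\ (n\in\mathbb Z) \mid (M,N) \mid \lambda x.M \mid M\,N \mid \mathsf{fix}\,x.M \mid M\otimes N \mid M\bowtie N \mid \mathsf{match}\ M\ \mathsf{with}\ |_{i=1}^k\, p_i\mapsto N_i ,$$ where $k\ge 1$ and $p_1,\dots,p_k$ are pairwise disjoint (no term is an instance of two of them). Values are the closed terms of the form $V ::= {'a}\mid \underline n\mid (V,W)\mid \lambda x.M$. One-step reduction $\rhd$ is the closure of $(\lambda x.M)N\rhd M[N/x]$; $\mathsf{fix}\,x.M\rhd M[\mathsf{fix}\,x.M/x]$; $\underline n\otimes\underline m\rhd\underline{n\otimes m}$; $\underline n\bowtie\underline m\rhd{'true}$ or ${'false}$, according to whether $n\bowtie m$ holds; $\mathsf{match}\ V\ \mathsf{with}\ |_i\,p_i\mapsto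 N_i\rhd N_j\sigma$ if the value $V$ is $p_j\sigma$; under the evaluation contexts $E ::= \square\mid E\,N\mid (E,N)\mid (V,E)\mid E\otimes N\mid\underline n\otimes E\mid E\bowtie N\mid\underline n\bowtie E\mid\mathsf{match}\ E\ \mathsf{with}\ |_i\,p_i\mapsto N_i$. A normal form is a term that cannot make a step. **Types.** $A ::= \top\mid\mathsf{Ok}\mid\mathsf{Atom}\mid\mathsf{Int}\mid{'a}\mid(A,B)\mid A\to B\mid\bigvee_{i=1}^kA_i\ (k\ge1)\mid\neg A$. Abbreviate $\bot=\neg\top$, $\mathsf{Pair}=(\top,\top)$, $\mathsf{PairVal}=(\mathsf{Ok},\mathsf{Ok})$, $\mathsf{Fun}=\bot\to\top$, $\mathsf{Bool}={'true}\vee{'false}$. Subtyping $\le$ is the least reflexive and transitive relation with: $A\le\top$; $\mathsf{Int}\vee\mathsf{PairVal}\vee\mathsf{Fun}\vee\mathsf{Atom}\le\mathsf{Ok}$; $'a\le\mathsf{Atom}$; $A\le\neg B$ whenever $A\ne B$ are two atoms or two members of $\{\mathsf{Int},\mathsf{Pair},\mathsf{Fun},\mathsf{Atom}\}$; $(\neg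 A,\top)\vee(\mathsf{Ok},\neg B)\le\neg(A,B)$; $(A,B)\le(A',B')$ if $A\le A'$ and $B\le B'$; $A\to B\le A'\to B'$ if $A'\le A$ and $B\le B'$; $\bigvee_iB_i\le A$ if all $B_i\le A$; $A\le\bigvee_iB_i$ if some $A\le B_j$; $\neg A\le B$ if $\neg B\le A$; $A\le\neg B$ if $B\le\neg A$. **Typing.** A typing formula is $M:A$ with $M$ a term, $A$ a type; contexts $\Gamma,\Delta$ are finite sets of typing formulas, and the comma is union. Bound variables in a rule are not free in the rest of its conclusion. A pattern type substitution $\theta$ for $p$ assigns a type $\theta(x)\le\mathsf{Ok}$ to each variable $x$ of $p$; it is also read as the set $\{x:\theta(x)\}$; $p\theta$ is the type obtained from $p$ by putting $\theta(x)$ for $x$, and $\theta_{\mathsf{Ok}}$ is constantly $\mathsf{Ok}$. In the *one-sided system*, $\Gamma$ contains only variable typings $x:A$. Its rules are as follows. * Axioms: $\Gamma,x:A\vdash x:A,\Delta$; $\Gamma\vdash M:\top,\Delta$; $\Gamma\vdash\underline n:\mathsf{Int},\Delta$; $\Gamma\vdash{'a}:{'a},\Delta$. * From $\Gamma\vdash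 M:A,\Delta$ with $A\le B$, infer $\Gamma\vdash M:B,\Delta$. * From $\Gamma,x:A\vdash\Delta$ infer $\Gamma\vdash x:\neg A,\Delta$. * From $\Gamma,x:A\vdash M:B,\Delta$ infer $\Gamma\vdash\lambda x.M:A\to B,\Delta$. From $\Gamma,x:A\vdash M:A,\Delta$ infer $\Gamma\vdash\mathsf{fix}\,x.M:A,\Delta$. * From $\Gamma\vdash M:A,\Delta$ and $\Gamma\vdash N:B,\Delta$ infer $\Gamma\vdash(M,N):(A,B),\Delta$. From $\Gamma\vdash M:B\to A,\Delta$ and $\Gamma\vdash N:B,\Delta$ infer $\Gamma\vdash M\,N:A,\Delta$. * From $\Gamma\vdash M:\mathsf{Int},\Delta$ and $\Gamma\vdash N:\mathsf{Int},\Delta$ infer $\Gamma\vdash M\otimes N:\mathsf{Int},\Delta$ and $\Gamma\vdash M\bowtie N:\mathsf{Bool},\Delta$. * From $\Gamma\vdash M:\bigvee_ip_i\theta_i,\Delta$ and, for all $i$, $\Gamma,\theta_i\vdash M:\neg(p_i\theta_i),N_i:A,\Delta$, infer $\Gamma\vdash\mathsf{match}\ M\ \mathsf{with}\ |_i\,p_i\mapsto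 N_i:A,\Delta$. * From $\Gamma\vdash M:\neg\mathsf{Int},N:\neg\mathsf{Int},\Delta$ infer $\Gamma\vdash M\otimes N:\neg\mathsf{Ok},\Delta$ and $\Gamma\vdash M\bowtie N:\neg\mathsf{Ok},\Delta$. * From $\Gamma\vdash M:\neg\mathsf{Ok},N:\neg\mathsf{Ok},\Delta$ infer $\Gamma\vdash(M,N):\neg\mathsf{Ok},\Delta$. From $\Gamma\vdash M:\neg\mathsf{Fun},\Delta$ infer $\Gamma\vdash M\,N:\neg\mathsf{Ok},\Delta$. * From $\Gamma\vdash M:\neg\bigvee_ip_i\theta_{\mathsf{Ok}},\Delta$ infer $\Gamma\vdash\mathsf{match}\ M\ \mathsf{with}\ |_i\,p_i\mapsto N_i:\neg\mathsf{Ok},\Delta$. In the *two-sided system*, $\Gamma$ is arbitrary. It has the axioms, the subtyping rule on the right and the rules for $\lambda$, $\mathsf{fix}$, pairs, application, and $\otimes,\bowtie$ at $\mathsf{Int},\mathsf{Bool}$ as above, and the following rules. * From $\Gamma,M:B\vdash\Delta$ with $A\le B$, infer $\Gamma,M:A\vdash\Delta$. * From $\Gamma\vdash M:A,\Delta$ infer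 $\Gamma,M:\neg A\vdash\Delta$. From $\Gamma,M:A\vdash\Delta$ infer $\Gamma\vdash M:\neg A,\Delta$. * From $\Gamma\vdash M:\bigvee_ip_i\theta_i,\Delta$ and, for all $i$, $\Gamma,\theta_i,M:p_i\theta_i\vdash N_i:A,\Delta$, infer $\Gamma\vdash\mathsf{match}\ M\ \mathsf{with}\ |_i\,p_i\mapsto N_i:A,\Delta$. * From $\Gamma,M:\mathsf{Int},N:\mathsf{Int}\vdash\Delta$ infer $\Gamma,M\otimes N:\mathsf{Ok}\vdash\Delta$ and $\Gamma,M\bowtie N:\mathsf{Ok}\vdash\Delta$. * From $\Gamma,M:\mathsf{Ok},N:\mathsf{Ok}\vdash\Delta$ infer $\Gamma,(M,N):\mathsf{Ok}\vdash\Delta$. From $\Gamma,M:\mathsf{Fun}\vdash\Delta$ infer $\Gamma,M\,N:\mathsf{Ok}\vdash\Delta$. * From $\Gamma,M:\bigvee_ip_i\theta_{\mathsf{Ok}}\vdash\Delta$ infer $\Gamma,\mathsf{match}\ M\ \mathsf{with}\ |_i\,p_i\mapsto N_i:\mathsf{Ok}\vdash\Delta$. **Theorem (Normal Form Cut Admissibility).**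 Let $U$ be a closed normal form. Then each of the following holds for derivability in the one-sided system, and also for derivability in the two-sided system. 1. For all types $A,B$ with $A\le\neg B$ and all contexts $\Gamma,\Delta$: if $\Gamma\vdash U:A,\Delta$ and $\Gamma\vdash U:B,\Delta$ are derivable, then $\Gamma\vdash\Delta$ is derivable. 2. In particular, for all $A,\Gamma,\Delta$: if $\Gamma\vdash U:A,\Delta$ and $\Gamma\vdash U:\neg A,\Delta$ are derivable, then $\Gamma\vdash\Delta$ is derivable. 3. In particular, there is no type $A$ such that $\vdash U:A$ and $\vdash U:\neg A$ are both derivable. -/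

import Mathlib

namespace TwoSidedTyping

/-! ## Syntax

Terms are represented with de Bruijn indices, so that terms that differ only in the names of bound
variables are equal. A free variable of a term is a natural number. -/

/-- A denumerable set of atoms with two distinguished ones. -/
inductive Atom : Type
  | tt : Atom
  | ff : Atom
  | named : ℕ → Atom

/-- Linear patterns. Since every variable occurs at most once, the variables of a pattern need no
names: they are numbered `0, 1, …, nvars - 1` from left to right. -/
inductive Pat : Type
  | var : Pat
  | atom : Atom → Pat
  | pair : Pat → Pat → Pat

/-- The number of variables of a pattern. -/
def Pat.nvars : Pat → ℕ
  | .var => 1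
  | .atom _ => 0
  | .pair p q => p.nvars + q.nvars

/-- Disjointness of patterns: no term matches both (see `Pat.apart_iff`). -/
def Pat.Apart : Pat → Pat → Prop
  | .atom a, .atom b => a ≠ b
  | .atom _, .pair _ _ => True
  | .pair _ _, .atom _ => True
  | .pair p q, .pair p' q' => p.Apart p' ∨ q.Apart q'
  | .var, _ => False
  | _, .var => False

/-- A choice of binary operations and of binary relations on the integers. -/
structure Signature where
  Op : Type
  Rel : Type
  evalOp : Op → ℤ → ℤ → ℤ
  evalRel : Rel → ℤ → ℤ → Bool

/-- Terms. `lam` and `fix` bind index `0` in their body; branch `i` of a match binds the indices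
`0, …, (p i).nvars - 1`, which stand for the variables of `p i`. A match has at least one branch,
and its patterns are pairwise disjoint. -/
inductive Term (S : Signature) : Type
  | var : ℕ → Term S
  | atom : Atom → Term S
  | num : ℤ → Term S
  | pair : Term S → Term S → Term S
  | lam : Term S → Term S
  | app : Term S → Term S → Term S
  | fix : Term S → Term S
  | binop : S.Op → Term S → Term S → Term S
  | relop : S.Rel → Term S → Term S → Term S
  | mtch (M : Term S) (k : ℕ) (p : Fin (k + 1) → Pat)
      (hp : ∀ i j, i ≠ j → (p i).Apart (p j)) (N : Fin (k + 1) → Term S) : Term S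

variable {S : Signature}

namespace Term

/-- `M.FreeIn x`: the variable `x` occurs free in `M`. -/
def FreeIn : Term S → ℕ → Prop
  | var y, x => x = y
  | atom _, _ => False
  | num _, _ => False
  | pair M N, x => M.FreeIn x ∨ N.FreeIn x
  | lam M, x => M.FreeIn (x + 1)
  | app M N, x => M.FreeIn x ∨ N.FreeIn x
  | fix M, x => M.FreeIn (x + 1)
  | binop _ M N, x => M.FreeIn x ∨ N.FreeIn x
  | relop _ M N, x => M.FreeIn x ∨ N.FreeIn x
  | mtch M _ p _ N, x => M.FreeIn x ∨ ∃ i, (N i).FreeIn (x + (p i).nvars)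

def Closed (M : Term S) : Prop := ∀ x, ¬ M.FreeIn x

/-- Extend a renaming under `n` binders. -/
def liftRen (n : ℕ) (r : ℕ → ℕ) (x : ℕ) : ℕ := if x < n then x else r (x - n) + n

def rename : (ℕ → ℕ) → Term S → Term S
  | r, var x => var (r x)
  | _, atom a => atom a
  | _, num n => num n
  | r, pair M N => pair (M.rename r) (N.rename r)
  | r, lam M => lam (M.rename (liftRen 1 r))
  | r, app M N => app (M.rename r) (N.rename r)
  | r, fix M => fix (M.rename (liftRen 1 r))
  | r, binop o M N => binop o (M.rename r) (N.rename r)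
  | r, relop o M N => relop o (M.rename r) (N.rename r)
  | r, mtch M k p hp N =>
      mtch (M.rename r) k p hp (fun i => (N i).rename (liftRen (p i).nvars r))

/-- Make room for `n` new variables `0, …, n - 1`. -/
def shift (n : ℕ) (M : Term S) : Term S := M.rename (· + n)

/-- Extend a substitution under `n` binders. -/
def liftSubst (n : ℕ) (σ : ℕ → Term S) (x : ℕ) : Term S :=
  if x < n then var x else (σ (x - n)).shift n

/-- Capture-avoiding simultaneous substitution. -/
def subst : (ℕ → Term S) → Term S → Term S
  | σ, var x => σ x
  | _, atom a => atom a
  | _, num n => num n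
  | σ, pair M N => pair (M.subst σ) (N.subst σ)
  | σ, lam M => lam (M.subst (liftSubst 1 σ))
  | σ, app M N => app (M.subst σ) (N.subst σ)
  | σ, fix M => fix (M.subst (liftSubst 1 σ))
  | σ, binop o M N => binop o (M.subst σ) (N.subst σ)
  | σ, relop o M N => relop o (M.subst σ) (N.subst σ)
  | σ, mtch M k p hp N =>
      mtch (M.subst σ) k p hp (fun i => (N i).subst (liftSubst (p i).nvars σ))

/-- The body `M` of a binder of `n` variables, with `σ 0, …, σ (n - 1)` put for these variables. -/
def inst (n : ℕ) (σ : ℕ → Term S) (M : Term S) : Term S :=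
  M.subst (fun x => if x < n then σ x else var (x - n))

/-- The grammar `V ::= 'a | n | (V, W) | λx.M`. -/
def ValueShape : Term S → Prop
  | atom _ => True
  | num _ => True
  | lam _ => True
  | pair M N => M.ValueShape ∧ N.ValueShape
  | _ => False

/-- Values are the closed terms of value shape. -/
def IsValue (M : Term S) : Prop := M.Closed ∧ M.ValueShape

end Term

/-- The instance `pσ` of a pattern; only `σ 0, …, σ (p.nvars - 1)` matter. -/
def Pat.toTerm : Pat → (ℕ → Term S) → Term S
  | .var, σ => σ 0
  | .atom a, _ => .atom a
  | .pair p q, σ => .pair (p.toTerm σ) (q.toTerm (fun n => σ (n + p.nvars)))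

theorem Pat.toTerm_congr (p : Pat) : ∀ {σ τ : ℕ → Term S}, (∀ n < p.nvars, σ n = τ n) →
    p.toTerm σ = p.toTerm τ := by
  induction p with
  | var => intro σ τ h; exact h 0 (by simp [Pat.nvars])
  | atom a => intro σ τ _; rfl
  | pair p q ihp ihq =>
    intro σ τ h
    simp only [Pat.nvars] at h
    simp only [Pat.toTerm]
    rw [ihp (fun n hn => h n (by omega)), ihq (fun n hn => h (n + p.nvars) (by omega))]

/-- Two patterns are apart just if no term is an instance of both. -/
theorem Pat.apart_iff (p : Pat) : ∀ q : Pat, p.Apart q ↔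
    ¬ ∃ (M : Term S) (σ τ : ℕ → Term S), M = p.toTerm σ ∧ M = q.toTerm τ := by
  induction p with
  | var =>
    intro q
    simp only [Pat.Apart, Pat.toTerm, false_iff, not_not]
    exact ⟨q.toTerm Term.var, fun _ => q.toTerm Term.var, Term.var, rfl, rfl⟩
  | atom a =>
    intro q
    cases q with
    | var =>
      simp only [Pat.Apart, Pat.toTerm, false_iff, not_not]
      exact ⟨.atom a, Term.var, fun _ => .atom a, rfl, rfl⟩
    | atom b =>
      simp only [Pat.Apart, Pat.toTerm]
      constructor
      · rintro h ⟨M, σ, τ, h1, h2⟩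
        rw [h1] at h2
        exact h (Term.atom.inj h2)
      · rintro h rfl
        exact h ⟨_, Term.var, Term.var, rfl, rfl⟩
    | pair q1 q2 =>
      simp only [Pat.Apart, Pat.toTerm, true_iff]
      rintro ⟨M, σ, τ, h1, h2⟩
      rw [h1] at h2
      cases h2
  | pair p1 p2 ih1 ih2 =>
    intro q
    cases q with
    | var =>
      simp only [Pat.Apart, false_iff, not_not]
      exact ⟨(Pat.pair p1 p2).toTerm Term.var, Term.var,
        fun _ => (Pat.pair p1 p2).toTerm Term.var, rfl, rfl⟩
    | atom b =>
      simp only [Pat.Apart, Pat.toTerm, true_iff]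
      rintro ⟨M, σ, τ, h1, h2⟩
      rw [h1] at h2
      cases h2
    | pair q1 q2 =>
      simp only [Pat.Apart]
      rw [ih1 q1, ih2 q2]
      constructor
      · rintro h ⟨M, σ, τ, h1, h2⟩
        rw [h1] at h2
        simp only [Pat.toTerm, Term.pair.injEq] at h2
        rcases h with h | h
        · exact h ⟨_, _, _, rfl, h2.1⟩
        · exact h ⟨_, _, _, rfl, h2.2⟩
      · intro h
        by_contra hc
        simp only [not_or, not_not] at hc
        obtain ⟨⟨M, σ, τ, h1, h2⟩, ⟨M', σ', τ', h1', h2'⟩⟩ := hc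
        refine h ⟨.pair M M', fun n => if n < p1.nvars then σ n else σ' (n - p1.nvars),
          fun n => if n < q1.nvars then τ n else τ' (n - q1.nvars), ?_, ?_⟩
        · simp only [Pat.toTerm, Term.pair.injEq]
          exact ⟨h1.trans (Pat.toTerm_congr _ (fun n hn => by simp [hn])),
            h1'.trans (Pat.toTerm_congr _ (fun n hn => by simp))⟩
        · simp only [Pat.toTerm, Term.pair.injEq]
          exact ⟨h2.trans (Pat.toTerm_congr _ (fun n hn => by simp [hn])),
            h2'.trans (Pat.toTerm_congr _ (fun n hn => by simp))⟩

/-! ## Reduction -/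

/-- One-step reduction: the redex rules closed under the evaluation contexts
`E ::= □ | E N | (E, N) | (V, E) | E ⊗ N | n ⊗ E | E ⋈ N | n ⋈ E | match E with …`. -/
inductive Step : Term S → Term S → Prop
  | beta (M N : Term S) : Step (.app (.lam M) N) (M.inst 1 (fun _ => N))
  | fix (M : Term S) : Step (.fix M) (M.inst 1 (fun _ => .fix M))
  | binop (o : S.Op) (m n : ℤ) : Step (.binop o (.num m) (.num n)) (.num (S.evalOp o m n))
  | relop (o : S.Rel) (m n : ℤ) :
      Step (.relop o (.num m) (.num n)) (.atom (if S.evalRel o m n then .tt else .ff))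
  | mtch (V : Term S) (k : ℕ) (p : Fin (k + 1) → Pat) (hp : ∀ i j, i ≠ j → (p i).Apart (p j))
      (N : Fin (k + 1) → Term S) (j : Fin (k + 1)) (σ : ℕ → Term S) :
      V.IsValue → V = (p j).toTerm σ →
      Step (.mtch V k p hp N) ((N j).inst (p j).nvars σ)
  | appCtx {M M' : Term S} (N : Term S) : Step M M' → Step (.app M N) (.app M' N)
  | pairL {M M' : Term S} (N : Term S) : Step M M' → Step (.pair M N) (.pair M' N)
  | pairR {N N' : Term S} (V : Term S) :
      V.IsValue → Step N N' → Step (.pair V N) (.pair V N')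
  | binopL {M M' : Term S} (o : S.Op) (N : Term S) :
      Step M M' → Step (.binop o M N) (.binop o M' N)
  | binopR {N N' : Term S} (o : S.Op) (n : ℤ) :
      Step N N' → Step (.binop o (.num n) N) (.binop o (.num n) N')
  | relopL {M M' : Term S} (o : S.Rel) (N : Term S) :
      Step M M' → Step (.relop o M N) (.relop o M' N)
  | relopR {N N' : Term S} (o : S.Rel) (n : ℤ) :
      Step N N' → Step (.relop o (.num n) N) (.relop o (.num n) N')
  | mtchCtx {M M' : Term S} (k : ℕ) (p : Fin (k + 1) → Pat)
      (hp : ∀ i j, i ≠ j → (p i).Apart (p j)) (N : Fin (k + 1) → Term S) :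
      Step M M' → Step (.mtch M k p hp N) (.mtch M' k p hp N)

/-- A normal form is a term that cannot make a step. -/
def NormalForm (M : Term S) : Prop := ∀ N, ¬ Step M N

/-! ## Types and subtyping -/

/-- Types; `union k A` is the union of the `k + 1` types `A 0, …, A k`. -/
inductive Ty : Type
  | top : Ty
  | ok : Ty
  | atoms : Ty
  | int : Ty
  | atom : Atom → Ty
  | pair : Ty → Ty → Ty
  | arr : Ty → Ty → Ty
  | union (k : ℕ) (A : Fin (k + 1) → Ty) : Ty
  | compl : Ty → Ty

namespace Ty

def bot : Ty := compl top
def pairTy : Ty := pair top top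
def pairVal : Ty := pair ok ok
def func : Ty := arr bot top
def bool : Ty := union 1 ![atom .tt, atom .ff]

end Ty

/-- The basic disjointness relation on types. -/
def DisTy (A B : Ty) : Prop :=
  A ≠ B ∧ ((∃ a b, A = .atom a ∧ B = .atom b) ∨
    (A ∈ ({.int, .pairTy, .func, .atoms} : Set Ty) ∧
      B ∈ ({.int, .pairTy, .func, .atoms} : Set Ty)))

/-- The subtype relation. -/
inductive Sub : Ty → Ty → Prop
  | refl (A : Ty) : Sub A A
  | top (A : Ty) : Sub A .top
  | ok : Sub (.union 3 ![.int, .pairVal, .func, .atoms]) .ok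
  | disj {A B : Ty} : DisTy A B → Sub A (.compl B)
  | atom (a : Atom) : Sub (.atom a) .atoms
  | pairC (A B : Ty) :
      Sub (.union 1 ![.pair (.compl A) .top, .pair .ok (.compl B)]) (.compl (.pair A B))
  | pair {A A' B B' : Ty} : Sub A A' → Sub B B' → Sub (.pair A B) (.pair A' B')
  | func {A A' B B' : Ty} : Sub A' A → Sub B B' → Sub (.arr A B) (.arr A' B')
  | unionL {k : ℕ} {B : Fin (k + 1) → Ty} {A : Ty} : (∀ i, Sub (B i) A) → Sub (.union k B) A
  | unionR {k : ℕ} {B : Fin (k + 1) → Ty} {A : Ty} (j : Fin (k + 1)) :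
      Sub A (B j) → Sub A (.union k B)
  | compL {A B : Ty} : Sub (.compl B) A → Sub (.compl A) B
  | compR {A B : Ty} : Sub B (.compl A) → Sub A (.compl B)
  | trans {A B C : Ty} : Sub A C → Sub C B → Sub A B

/-- The type `pθ` of a pattern under a pattern type substitution; only the values
`θ 0, …, θ (p.nvars - 1)` at the variables of the pattern matter. -/
def Pat.toTy : Pat → (ℕ → Ty) → Ty
  | .var, θ => θ 0
  | .atom a, _ => .atom a
  | .pair p q, θ => .pair (p.toTy θ) (q.toTy (fun n => θ (n + p.nvars)))

/-- The side condition on pattern type substitutions: all types in the range are below `ok`. -/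
def PatSubst (p : Pat) (θ : ℕ → Ty) : Prop := ∀ x < p.nvars, Sub (θ x) .ok

/-! ## Typing

In a rule with a bound variable, the requirement that it is not free in the surrounding context is
expressed by shifting the context. -/

noncomputable section

instance : DecidableEq Ty := Classical.decEq _
instance : DecidableEq (Term S) := Classical.decEq _

/-- A variable typing `x : A`. -/
abbrev VarTyping : Type := ℕ × Ty

/-- A typing formula `M : A`. -/
abbrev Formula (S : Signature) : Type := Term S × Ty

def shiftVars (n : ℕ) (Γ : Finset VarTyping) : Finset VarTyping :=
  Γ.image (fun φ => (φ.1 + n, φ.2))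

def shiftCtx (n : ℕ) (Δ : Finset (Formula S)) : Finset (Formula S) :=
  Δ.image (fun φ => (φ.1.shift n, φ.2))

/-- The set of variable typings `{x : θ x | x < n}` of a pattern type substitution. -/
def substVars (n : ℕ) (θ : ℕ → Ty) : Finset VarTyping :=
  (Finset.range n).image (fun x => (x, θ x))

/-- The same set, as a set of typing formulas. -/
def substCtx (n : ℕ) (θ : ℕ → Ty) : Finset (Formula S) :=
  (Finset.range n).image (fun x => (.var x, θ x))

/-- Derivability in the one-sided system: only variable typings on the left. -/
inductive OneSided : Finset VarTyping → Finset (Formula S) → Prop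
  | var (Γ : Finset VarTyping) (Δ : Finset (Formula S)) (x : ℕ) (A : Ty) :
      OneSided (insert (x, A) Γ) (insert (.var x, A) Δ)
  | top (Γ : Finset VarTyping) (Δ : Finset (Formula S)) (M : Term S) :
      OneSided Γ (insert (M, .top) Δ)
  | num (Γ : Finset VarTyping) (Δ : Finset (Formula S)) (n : ℤ) :
      OneSided Γ (insert (.num n, .int) Δ)
  | atom (Γ : Finset VarTyping) (Δ : Finset (Formula S)) (a : Atom) :
      OneSided Γ (insert (.atom a, .atom a) Δ)
  | abs {Γ : Finset VarTyping} {Δ : Finset (Formula S)} {M : Term S} {A B : Ty} :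
      OneSided (insert (0, A) (shiftVars 1 Γ)) (insert (M, B) (shiftCtx 1 Δ)) →
      OneSided Γ (insert (.lam M, .arr A B) Δ)
  | sub {Γ : Finset VarTyping} {Δ : Finset (Formula S)} {M : Term S} {A B : Ty} :
      Sub A B → OneSided Γ (insert (M, A) Δ) → OneSided Γ (insert (M, B) Δ)
  | comp {Γ : Finset VarTyping} {Δ : Finset (Formula S)} {x : ℕ} {A : Ty} :
      OneSided (insert (x, A) Γ) Δ → OneSided Γ (insert (.var x, .compl A) Δ)
  | pair {Γ : Finset VarTyping} {Δ : Finset (Formula S)} {M N : Term S} {A B : Ty} :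
      OneSided Γ (insert (M, A) Δ) → OneSided Γ (insert (N, B) Δ) →
      OneSided Γ (insert (.pair M N, .pair A B) Δ)
  | binop {Γ : Finset VarTyping} {Δ : Finset (Formula S)} {o : S.Op} {M N : Term S} :
      OneSided Γ (insert (M, .int) Δ) → OneSided Γ (insert (N, .int) Δ) →
      OneSided Γ (insert (.binop o M N, .int) Δ)
  | relop {Γ : Finset VarTyping} {Δ : Finset (Formula S)} {o : S.Rel} {M N : Term S} :
      OneSided Γ (insert (M, .int) Δ) → OneSided Γ (insert (N, .int) Δ) →
      OneSided Γ (insert (.relop o M N, .bool) Δ)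
  | app {Γ : Finset VarTyping} {Δ : Finset (Formula S)} {M N : Term S} {A B : Ty} :
      OneSided Γ (insert (M, .arr B A) Δ) → OneSided Γ (insert (N, B) Δ) →
      OneSided Γ (insert (.app M N, A) Δ)
  | fix {Γ : Finset VarTyping} {Δ : Finset (Formula S)} {M : Term S} {A : Ty} :
      OneSided (insert (0, A) (shiftVars 1 Γ)) (insert (M, A) (shiftCtx 1 Δ)) →
      OneSided Γ (insert (.fix M, A) Δ)
  | mtch {Γ : Finset VarTyping} {Δ : Finset (Formula S)} {M : Term S} {k : ℕ}
      {p : Fin (k + 1) → Pat} {hp : ∀ i j, i ≠ j → (p i).Apart (p j)} {N : Fin (k + 1) → Term S}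
      {A : Ty} (θ : Fin (k + 1) → ℕ → Ty) :
      (∀ i, PatSubst (p i) (θ i)) →
      OneSided Γ (insert (M, .union k (fun i => (p i).toTy (θ i))) Δ) →
      (∀ i, OneSided (substVars (p i).nvars (θ i) ∪ shiftVars (p i).nvars Γ)
        (insert (M.shift (p i).nvars, .compl ((p i).toTy (θ i)))
          (insert (N i, A) (shiftCtx (p i).nvars Δ)))) →
      OneSided Γ (insert (.mtch M k p hp N, A) Δ)
  | binopE {Γ : Finset VarTyping} {Δ : Finset (Formula S)} {o : S.Op} {M N : Term S} :
      OneSided Γ (insert (M, .compl .int) (insert (N, .compl .int) Δ)) →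
      OneSided Γ (insert (.binop o M N, .compl .ok) Δ)
  | relopE {Γ : Finset VarTyping} {Δ : Finset (Formula S)} {o : S.Rel} {M N : Term S} :
      OneSided Γ (insert (M, .compl .int) (insert (N, .compl .int) Δ)) →
      OneSided Γ (insert (.relop o M N, .compl .ok) Δ)
  | pairE {Γ : Finset VarTyping} {Δ : Finset (Formula S)} {M N : Term S} :
      OneSided Γ (insert (M, .compl .ok) (insert (N, .compl .ok) Δ)) →
      OneSided Γ (insert (.pair M N, .compl .ok) Δ)
  | appE {Γ : Finset VarTyping} {Δ : Finset (Formula S)} {M N : Term S} :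
      OneSided Γ (insert (M, .compl .func) Δ) →
      OneSided Γ (insert (.app M N, .compl .ok) Δ)
  | mtchE {Γ : Finset VarTyping} {Δ : Finset (Formula S)} {M : Term S} {k : ℕ}
      {p : Fin (k + 1) → Pat} {hp : ∀ i j, i ≠ j → (p i).Apart (p j)}
      {N : Fin (k + 1) → Term S} :
      OneSided Γ (insert (M, .compl (.union k (fun i => (p i).toTy (fun _ => .ok)))) Δ) →
      OneSided Γ (insert (.mtch M k p hp N, .compl .ok) Δ)

/-- Derivability in the two-sided system. -/
inductive TwoSided : Finset (Formula S) → Finset (Formula S) → Prop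
  | var (Γ Δ : Finset (Formula S)) (x : ℕ) (A : Ty) :
      TwoSided (insert (.var x, A) Γ) (insert (.var x, A) Δ)
  | top (Γ Δ : Finset (Formula S)) (M : Term S) : TwoSided Γ (insert (M, .top) Δ)
  | num (Γ Δ : Finset (Formula S)) (n : ℤ) : TwoSided Γ (insert (.num n, .int) Δ)
  | atom (Γ Δ : Finset (Formula S)) (a : Atom) : TwoSided Γ (insert (.atom a, .atom a) Δ)
  | subL {Γ Δ : Finset (Formula S)} {M : Term S} {A B : Ty} :
      Sub A B → TwoSided (insert (M, B) Γ) Δ → TwoSided (insert (M, A) Γ) Δ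
  | subR {Γ Δ : Finset (Formula S)} {M : Term S} {A B : Ty} :
      Sub B A → TwoSided Γ (insert (M, B) Δ) → TwoSided Γ (insert (M, A) Δ)
  | compL {Γ Δ : Finset (Formula S)} {M : Term S} {A : Ty} :
      TwoSided Γ (insert (M, A) Δ) → TwoSided (insert (M, .compl A) Γ) Δ
  | compR {Γ Δ : Finset (Formula S)} {M : Term S} {A : Ty} :
      TwoSided (insert (M, A) Γ) Δ → TwoSided Γ (insert (M, .compl A) Δ)
  | binop {Γ Δ : Finset (Formula S)} {o : S.Op} {M N : Term S} :
      TwoSided Γ (insert (M, .int) Δ) → TwoSided Γ (insert (N, .int) Δ) →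
      TwoSided Γ (insert (.binop o M N, .int) Δ)
  | relop {Γ Δ : Finset (Formula S)} {o : S.Rel} {M N : Term S} :
      TwoSided Γ (insert (M, .int) Δ) → TwoSided Γ (insert (N, .int) Δ) →
      TwoSided Γ (insert (.relop o M N, .bool) Δ)
  | fix {Γ Δ : Finset (Formula S)} {M : Term S} {A : Ty} :
      TwoSided (insert (.var 0, A) (shiftCtx 1 Γ)) (insert (M, A) (shiftCtx 1 Δ)) →
      TwoSided Γ (insert (.fix M, A) Δ)
  | pair {Γ Δ : Finset (Formula S)} {M N : Term S} {A B : Ty} :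
      TwoSided Γ (insert (M, A) Δ) → TwoSided Γ (insert (N, B) Δ) →
      TwoSided Γ (insert (.pair M N, .pair A B) Δ)
  | abs {Γ Δ : Finset (Formula S)} {M : Term S} {A B : Ty} :
      TwoSided (insert (.var 0, A) (shiftCtx 1 Γ)) (insert (M, B) (shiftCtx 1 Δ)) →
      TwoSided Γ (insert (.lam M, .arr A B) Δ)
  | app {Γ Δ : Finset (Formula S)} {M N : Term S} {A B : Ty} :
      TwoSided Γ (insert (M, .arr B A) Δ) → TwoSided Γ (insert (N, B) Δ) →
      TwoSided Γ (insert (.app M N, A) Δ)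
  | mtch {Γ Δ : Finset (Formula S)} {M : Term S} {k : ℕ}
      {p : Fin (k + 1) → Pat} {hp : ∀ i j, i ≠ j → (p i).Apart (p j)} {N : Fin (k + 1) → Term S}
      {A : Ty} (θ : Fin (k + 1) → ℕ → Ty) :
      (∀ i, PatSubst (p i) (θ i)) →
      TwoSided Γ (insert (M, .union k (fun i => (p i).toTy (θ i))) Δ) →
      (∀ i, TwoSided
        (insert (M.shift (p i).nvars, (p i).toTy (θ i))
          (substCtx (p i).nvars (θ i) ∪ shiftCtx (p i).nvars Γ))
        (insert (N i, A) (shiftCtx (p i).nvars Δ))) →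
      TwoSided Γ (insert (.mtch M k p hp N, A) Δ)
  | binopE {Γ Δ : Finset (Formula S)} {o : S.Op} {M N : Term S} :
      TwoSided (insert (M, .int) (insert (N, .int) Γ)) Δ →
      TwoSided (insert (.binop o M N, .ok) Γ) Δ
  | relopE {Γ Δ : Finset (Formula S)} {o : S.Rel} {M N : Term S} :
      TwoSided (insert (M, .int) (insert (N, .int) Γ)) Δ →
      TwoSided (insert (.relop o M N, .ok) Γ) Δ
  | appE {Γ Δ : Finset (Formula S)} {M N : Term S} :
      TwoSided (insert (M, .func) Γ) Δ →
      TwoSided (insert (.app M N, .ok) Γ) Δ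
  | mtchE {Γ Δ : Finset (Formula S)} {M : Term S} {k : ℕ}
      {p : Fin (k + 1) → Pat} {hp : ∀ i j, i ≠ j → (p i).Apart (p j)}
      {N : Fin (k + 1) → Term S} :
      TwoSided (insert (M, .union k (fun i => (p i).toTy (fun _ => .ok))) Γ) Δ →
      TwoSided (insert (.mtch M k p hp N, .ok) Γ) Δ
  | pairE {Γ Δ : Finset (Formula S)} {M N : Term S} :
      TwoSided (insert (M, .ok) (insert (N, .ok) Γ)) Δ →
      TwoSided (insert (.pair M N, .ok) Γ) Δ

end

end TwoSidedTyping

namespace TwoSidedTyping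

variable {S : Signature}

/-! ## Closed terms and normal forms -/

namespace Term

/-! Types are read as sets of terms in a two-valued model, `Ty.Holds`. It is crude, since all arrow
types denote the set of abstractions, but subtyping is sound for it (`Sub.holds`). A formula about a
closed normal form is refuted if the model makes it false. A rule either cannot conclude a refuted
formula on the right, or has a premise in which all the active formulas can be erased in turn: the
head of a stuck application is not an abstraction, the scrutinee of a stuck match has none of the
pattern types, and so on. Induction on derivations therefore erases refuted formulas
(`OneSided.remove_refuted`). In the two-sided system true formulas are erased on the left at the
same time, because the complement rules exchange the sides (`TwoSided.remove_verified_refuted`). A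
cut is then a case distinction: if `A` is a subtype of the complement of `B`, one of the two is
false of `U`, and the derivation that contains it can do without it.

The delicate case is a pair whose first component is stuck: its second component need not be normal,
so nothing can be erased there. The model ignores the second component of such a pair. This agrees
with subtyping because the axiom for the complement of a pair type asks for `ok`, not `top`, on the
left of its second disjunct. -/

theorem rename_eq_self (M : Term S) :
    ∀ r : ℕ → ℕ, (∀ x, M.FreeIn x → r x = x) → M.rename r = M := by
  have lift : ∀ (N : Term S) (n : ℕ) (r : ℕ → ℕ), (∀ x, N.FreeIn (x + n) → r x = x) →
      ∀ x, N.FreeIn x → liftRen n r x = x := by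
    intro N n r h x hx
    unfold liftRen
    split_ifs with hn
    · rfl
    · have hx' : x - n + n = x := by omega
      rw [h (x - n) (by rwa [hx']), hx']
  induction M with
  | var y => intro r h; exact congrArg var (h y rfl)
  | atom a => intro r _; rfl
  | num n => intro r _; rfl
  | pair M N ihM ihN | app M N ihM ihN | binop o M N ihM ihN | relop o M N ihM ihN =>
    intro r h
    simp only [rename]
    rw [ihM r fun x hx => h x (Or.inl hx), ihN r fun x hx => h x (Or.inr hx)]
  | lam M ih | fix M ih =>
    intro r h
    simp only [rename]
    rw [ih _ (lift M 1 r h)]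
  | mtch M k p hp N ihM ihN =>
    intro r h
    simp only [rename]
    rw [ihM r fun x hx => h x (Or.inl hx)]
    congr 1
    funext i
    exact ihN i _ (lift (N i) _ r fun x hx => h x (Or.inr ⟨i, hx⟩))

/-- This lets a formula about a closed term remain the same formula when a context is moved under a
binder. -/
theorem Closed.shift_eq {M : Term S} (h : M.Closed) (n : ℕ) : M.shift n = M :=
  M.rename_eq_self _ fun x hx => (h x hx).elim

/-- The shape of the terms of function type. -/
def IsLam : Term S → Prop
  | lam _ => True
  | _ => False

/-- The closed normal forms. -/
structure ClosedNormal (M : Term S) : Prop where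
  closed : M.Closed
  normal : NormalForm M

/-! ### Inversion of closed normal forms -/

namespace ClosedNormal

variable {M N : Term S}

theorem pair_left (h : (pair M N).ClosedNormal) : M.ClosedNormal :=
  ⟨fun x hx => h.closed x (Or.inl hx), fun _ hs => h.normal _ (.pairL N hs)⟩

/-- Evaluation enters the second component only behind a value; without `hM` it could still contain
a redex. -/
theorem pair_right (h : (pair M N).ClosedNormal) (hM : M.ValueShape) : N.ClosedNormal :=
  ⟨fun x hx => h.closed x (Or.inr hx),
    fun _ hs => h.normal _ (.pairR M ⟨h.pair_left.closed, hM⟩ hs)⟩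

theorem app_left (h : (app M N).ClosedNormal) : M.ClosedNormal ∧ ¬ M.IsLam := by
  refine ⟨⟨fun x hx => h.closed x (Or.inl hx), fun _ hs => h.normal _ (.appCtx N hs)⟩, ?_⟩
  intro hM
  cases M with
  | lam M => exact h.normal _ (.beta M N)
  | _ => exact hM

/-- Operands are evaluated from left to right, so the blame falls on the left operand unless it is a
numeral, and only then is the right one known to be normal. -/
theorem binop_cases {o : S.Op} (h : (binop o M N).ClosedNormal) :
    (M.ClosedNormal ∧ ∀ n, M ≠ num n) ∨ (N.ClosedNormal ∧ ∀ n, N ≠ num n) := by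
  by_cases hM : ∃ m, M = num m
  · obtain ⟨m, rfl⟩ := hM
    refine Or.inr ⟨⟨fun x hx => h.closed x (Or.inr hx),
      fun _ hs => h.normal _ (.binopR o m hs)⟩, ?_⟩
    rintro n rfl
    exact h.normal _ (.binop o m n)
  · exact Or.inl ⟨⟨fun x hx => h.closed x (Or.inl hx),
      fun _ hs => h.normal _ (.binopL o N hs)⟩, fun n hn => hM ⟨n, hn⟩⟩

theorem relop_cases {o : S.Rel} (h : (relop o M N).ClosedNormal) :
    (M.ClosedNormal ∧ ∀ n, M ≠ num n) ∨ (N.ClosedNormal ∧ ∀ n, N ≠ num n) := by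
  by_cases hM : ∃ m, M = num m
  · obtain ⟨m, rfl⟩ := hM
    refine Or.inr ⟨⟨fun x hx => h.closed x (Or.inr hx),
      fun _ hs => h.normal _ (.relopR o m hs)⟩, ?_⟩
    rintro n rfl
    exact h.normal _ (.relop o m n)
  · exact Or.inl ⟨⟨fun x hx => h.closed x (Or.inl hx),
      fun _ hs => h.normal _ (.relopL o N hs)⟩, fun n hn => hM ⟨n, hn⟩⟩

theorem mtch_scrutinee {k : ℕ} {p : Fin (k + 1) → Pat}
    {hp : ∀ i j, i ≠ j → (p i).Apart (p j)} {N : Fin (k + 1) → Term S}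
    (h : (mtch M k p hp N).ClosedNormal) :
    M.ClosedNormal ∧ (M.ValueShape → ∀ i σ, M ≠ (p i).toTerm σ) := by
  have hM : M.Closed := fun x hx => h.closed x (Or.inl hx)
  exact ⟨⟨hM, fun _ hs => h.normal _ (.mtchCtx k p hp N hs)⟩,
    fun hv i σ he => h.normal _ (.mtch M k p hp N i σ ⟨hM, hv⟩ he)⟩

theorem not_var {x : ℕ} (h : (var x : Term S).ClosedNormal) : False := h.closed x rfl

theorem not_fix (h : (fix M).ClosedNormal) : False := h.normal _ (.fix M)

end ClosedNormal

end Term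

/-! ## A model of the types

Arrow types do not distinguish between abstractions. The second component of a pair counts only
if the first one is a value, since otherwise it is never evaluated. -/

/-- `A.Holds M`: the term `M` has the type `A` in the model. -/
def Ty.Holds : Ty → Term S → Prop
  | .top, _ => True
  | .ok, M => M.ValueShape
  | .atoms, M => ∃ a, M = .atom a
  | .int, M => ∃ n, M = .num n
  | .atom a, M => M = .atom a
  | .pair A B, M => ∃ M₁ M₂, M = .pair M₁ M₂ ∧ A.Holds M₁ ∧ (M₁.ValueShape → B.Holds M₂)
  | .arr _ _, M => M.IsLam
  | .union _ A, M => ∃ i, (A i).Holds M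
  | .compl A, M => ¬ A.Holds M

/-- The four basic types are told apart by the outermost constructor of the term, and distinct atom
types by the atom itself. -/
theorem DisTy.not_holds {A B : Ty} (h : DisTy A B) {M : Term S} (hA : A.Holds M) :
    ¬ B.Holds M := by
  intro hB
  obtain ⟨hne, ⟨a, b, rfl, rfl⟩ | ⟨h₁, h₂⟩⟩ := h
  · cases hA
    cases hB
    exact hne rfl
  · simp only [Set.mem_insert_iff, Set.mem_singleton_iff] at h₁ h₂
    rcases h₁ with rfl | rfl | rfl | rfl <;> rcases h₂ with rfl | rfl | rfl | rfl <;>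
      first
      | exact hne rfl
      | (cases M <;> simp [Ty.Holds, Ty.pairTy, Ty.func, Term.IsLam] at hA hB)

/-- Subtyping is sound for the model. -/
theorem Sub.holds {A B : Ty} (h : Sub A B) : ∀ {M : Term S}, A.Holds M → B.Holds M := by
  induction h with
  | refl A => exact id
  | top A => intro M _; trivial
  | ok =>
    rintro M ⟨i, hi⟩
    fin_cases i
    · obtain ⟨n, rfl⟩ := hi
      trivial
    · obtain ⟨M₁, M₂, rfl, h₁, h₂⟩ := hi
      exact ⟨h₁, h₂ h₁⟩
    · cases M <;> trivial
    · obtain ⟨a, rfl⟩ := hi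
      trivial
  | disj h => intro M hA; exact h.not_holds hA
  | atom a => rintro M rfl; exact ⟨a, rfl⟩
  | pairC A B =>
    rintro M ⟨i, hi⟩ ⟨N₁, N₂, rfl, hN₁, hN₂⟩
    fin_cases i
    · obtain ⟨M₁, M₂, he, h₁, -⟩ := hi
      cases he
      exact h₁ hN₁
    -- Here the first component has type `ok`, so it is a value, and both conditional claims about
    -- the second component take effect.
    · obtain ⟨M₁, M₂, he, h₁, h₂⟩ := hi
      cases he
      exact h₂ h₁ (hN₂ h₁)
  | pair _ _ ih₁ ih₂ =>
    rintro M ⟨M₁, M₂, rfl, h₁, h₂⟩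
    exact ⟨M₁, M₂, rfl, ih₁ h₁, fun hv => ih₂ (h₂ hv)⟩
  | func _ _ _ _ => exact id
  | unionL _ ih => rintro M ⟨i, hi⟩; exact ih i hi
  | unionR j _ ih => intro M hM; exact ⟨j, ih hM⟩
  | compL _ ih => intro M hM; exact by_contra fun hB => hM (ih hB)
  | compR _ ih => intro M hM hB; exact ih hB hM
  | trans _ _ ih₁ ih₂ => intro M hM; exact ih₂ (ih₁ hM)

/-- A term that has a pattern type in the model is a value and an instance of the pattern. -/
theorem Pat.valueShape_and_instance_of_holds (p : Pat) :
    ∀ {θ : ℕ → Ty} {M : Term S}, PatSubst p θ → (p.toTy θ).Holds M →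
      M.ValueShape ∧ ∃ σ, M = p.toTerm σ := by
  induction p with
  | var =>
    intro θ M hθ hM
    -- The bound `ok` on pattern type substitutions is what makes the matched term a value.
    exact ⟨(hθ 0 (by simp [Pat.nvars])).holds hM, fun _ => M, rfl⟩
  | atom a =>
    rintro θ M - rfl
    exact ⟨trivial, Term.var, rfl⟩
  | pair p q ihp ihq =>
    rintro θ M hθ ⟨M₁, M₂, rfl, h₁, h₂⟩
    simp only [PatSubst, Pat.nvars] at hθ
    obtain ⟨hv₁, σ, hσ⟩ := ihp (fun x hx => hθ x (by omega)) h₁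
    obtain ⟨hv₂, τ, hτ⟩ := ihq (fun x hx => hθ (x + p.nvars) (by omega)) (h₂ hv₁)
    -- The variables of `q` are numbered after those of `p`, so the two substitutions are
    -- concatenated.
    refine ⟨⟨hv₁, hv₂⟩, fun n => if n < p.nvars then σ n else τ (n - p.nvars), ?_⟩
    simp only [Pat.toTerm, Term.pair.injEq]
    exact ⟨hσ.trans (Pat.toTerm_congr _ fun n hn => by simp [hn]),
      hτ.trans (Pat.toTerm_congr _ fun n hn => by simp)⟩

/-- A scrutinee with one of the pattern types would be a value matching that pattern, and the match
would reduce. -/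
theorem Term.ClosedNormal.not_holds_patterns {M : Term S} {k : ℕ} {p : Fin (k + 1) → Pat}
    {hp : ∀ i j, i ≠ j → (p i).Apart (p j)} {N : Fin (k + 1) → Term S}
    (h : (Term.mtch M k p hp N).ClosedNormal) {θ : Fin (k + 1) → ℕ → Ty}
    (hθ : ∀ i, PatSubst (p i) (θ i)) :
    ¬ (Ty.union k fun i => (p i).toTy (θ i)).Holds M := by
  rintro ⟨i, hi⟩
  obtain ⟨hv, σ, hσ⟩ := (p i).valueShape_and_instance_of_holds (hθ i) hi
  exact h.mtch_scrutinee.2 hv i σ hσ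

/-! ## Elimination of refuted and verified formulas -/

/-- A formula about a closed normal form that is false in the model. -/
def Refuted (φ : Formula S) : Prop := φ.1.ClosedNormal ∧ ¬ φ.2.Holds φ.1

/-- A formula about a closed normal form that is true in the model. -/
def Verified (φ : Formula S) : Prop := φ.1.ClosedNormal ∧ φ.2.Holds φ.1

/-- Every formula of `Γ` belongs to `Γ'` or is a formula about a closed term satisfying `P`. -/
def SubsetUpTo (P : Formula S → Prop) (Γ Γ' : Finset (Formula S)) : Prop :=
  ∀ φ ∈ Γ, φ ∈ Γ' ∨ (φ.1.Closed ∧ P φ)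

/-! ### Inclusion of contexts up to removable formulas -/

namespace SubsetUpTo

variable {P : Formula S → Prop} {Γ Γ' : Finset (Formula S)} {φ : Formula S}

theorem insert_both (h : SubsetUpTo P Γ Γ') (φ : Formula S) :
    SubsetUpTo P (insert φ Γ) (insert φ Γ') := by
  intro ψ hψ
  rcases Finset.mem_insert.1 hψ with rfl | hψ
  · exact Or.inl (Finset.mem_insert_self _ _)
  · exact (h ψ hψ).imp_left Finset.mem_insert_of_mem

theorem insert_left (h : SubsetUpTo P Γ Γ') (hc : φ.1.Closed) (hφ : P φ) :
    SubsetUpTo P (insert φ Γ) Γ' := by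
  intro ψ hψ
  rcases Finset.mem_insert.1 hψ with rfl | hψ
  · exact Or.inr ⟨hc, hφ⟩
  · exact h ψ hψ

theorem union_left (h : SubsetUpTo P Γ Γ') (Θ : Finset (Formula S)) :
    SubsetUpTo P (Θ ∪ Γ) (Θ ∪ Γ') := by
  intro ψ hψ
  rcases Finset.mem_union.1 hψ with hψ | hψ
  · exact Or.inl (Finset.mem_union_left _ hψ)
  · exact (h ψ hψ).imp_left (Finset.mem_union_right _)

/-- Removable formulas are about closed terms, so shifting leaves them unchanged and they stay
removable under a binder. -/
theorem shift (h : SubsetUpTo P Γ Γ') (n : ℕ) :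
    SubsetUpTo P (shiftCtx n Γ) (shiftCtx n Γ') := by
  intro ψ hψ
  obtain ⟨φ, hφ, rfl⟩ := Finset.mem_image.1 hψ
  rcases h φ hφ with hφ' | ⟨hc, hP⟩
  · exact Or.inl (Finset.mem_image_of_mem _ hφ')
  · rw [hc.shift_eq]
    exact Or.inr ⟨hc, hP⟩

theorem tail (h : SubsetUpTo P (insert φ Γ) Γ') : SubsetUpTo P Γ Γ' :=
  fun ψ hψ => h ψ (Finset.mem_insert_of_mem hψ)

/-- This is the case distinction on the principal formula of a rule. If it is kept, the equation
displays the target as a conclusion of the same rule, with contraction absorbed by the use of sets.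
-/
theorem head (h : SubsetUpTo P (insert φ Γ) Γ') : insert φ Γ' = Γ' ∨ (φ.1.Closed ∧ P φ) :=
  (h φ (Finset.mem_insert_self _ _)).imp_left Finset.insert_eq_of_mem

theorem refl (Γ : Finset (Formula S)) : SubsetUpTo P Γ Γ := fun _ => Or.inl

end SubsetUpTo

abbrev UpToRefuted (Δ Δ' : Finset (Formula S)) : Prop := SubsetUpTo Refuted Δ Δ'

abbrev UpToVerified (Γ Γ' : Finset (Formula S)) : Prop := SubsetUpTo Verified Γ Γ'

theorem SubsetUpTo.drop_refuted {Δ Δ' : Finset (Formula S)} {M : Term S} {A : Ty}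
    (h : UpToRefuted Δ Δ') (hM : M.ClosedNormal) (hA : ¬ A.Holds M) :
    UpToRefuted (insert (M, A) Δ) Δ' :=
  h.insert_left hM.closed ⟨hM, hA⟩

theorem SubsetUpTo.drop_verified {Γ Γ' : Finset (Formula S)} {M : Term S} {A : Ty}
    (h : UpToVerified Γ Γ') (hM : M.ClosedNormal) (hA : A.Holds M) :
    UpToVerified (insert (M, A) Γ) Γ' :=
  h.insert_left hM.closed ⟨hM, hA⟩

theorem not_holds_int {M : Term S} (h : ∀ n, M ≠ .num n) : ¬ Ty.int.Holds M :=
  fun ⟨n, hn⟩ => h n hn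

/-- In the one-sided system, derivability is preserved by weakening and by the removal of refuted
formulas. -/
theorem OneSided.remove_refuted {Γ : Finset VarTyping} {Δ : Finset (Formula S)}
    (h : OneSided Γ Δ) : ∀ {Γ' : Finset VarTyping} {Δ' : Finset (Formula S)}, Γ ⊆ Γ' →
      UpToRefuted Δ Δ' → OneSided Γ' Δ' := by
  induction h with
  | var Γ Δ x A =>
    intro Γ' Δ' hΓ hΔ
    rcases hΔ.head with he | ⟨-, hr, -⟩
    · rw [← Finset.insert_eq_of_mem (hΓ (Finset.mem_insert_self _ _)), ← he]
      exact .var Γ' Δ' x A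
    · exact hr.not_var.elim
  | top Γ Δ M =>
    intro Γ' Δ' hΓ hΔ
    rcases hΔ.head with he | ⟨-, -, hr⟩
    · rw [← he]
      exact .top Γ' Δ' M
    · exact (hr trivial).elim
  | num Γ Δ n =>
    intro Γ' Δ' hΓ hΔ
    rcases hΔ.head with he | ⟨-, -, hr⟩
    · rw [← he]
      exact .num Γ' Δ' n
    · exact (hr ⟨n, rfl⟩).elim
  | atom Γ Δ a =>
    intro Γ' Δ' hΓ hΔ
    rcases hΔ.head with he | ⟨-, -, hr⟩
    · rw [← he]
      exact .atom Γ' Δ' a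
    · exact (hr rfl).elim
  | abs _ ih =>
    intro Γ' Δ' hΓ hΔ
    rcases hΔ.head with he | ⟨-, -, hr⟩
    · rw [← he]
      exact .abs (ih (Finset.insert_subset_insert _ (Finset.image_subset_image hΓ))
        ((hΔ.tail.shift 1).insert_both _))
    -- An abstraction has every arrow type in the model, so nothing ever has to be erased about its
    -- open body.
    · exact (hr trivial).elim
  | sub hs _ ih =>
    intro Γ' Δ' hΓ hΔ
    rcases hΔ.head with he | ⟨-, hn, hr⟩
    · rw [← he]
      exact .sub hs (ih hΓ (hΔ.tail.insert_both _))
    · exact ih hΓ (hΔ.tail.drop_refuted hn fun h => hr (hs.holds h))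
  | comp _ ih =>
    intro Γ' Δ' hΓ hΔ
    rcases hΔ.head with he | ⟨-, hn, -⟩
    · rw [← he]
      exact .comp (ih (Finset.insert_subset_insert _ hΓ) hΔ.tail)
    · exact hn.not_var.elim
  | pair _ _ ih₁ ih₂ =>
    intro Γ' Δ' hΓ hΔ
    rcases hΔ.head with he | ⟨-, hn, hr⟩
    · rw [← he]
      exact .pair (ih₁ hΓ (hΔ.tail.insert_both _)) (ih₂ hΓ (hΔ.tail.insert_both _))
    -- If neither premise yields the goal, both components satisfy their types, against `hr`. The
    -- second is known to be normal only when the first is a value, which is the only case in which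
    -- the model asks about it.
    · by_contra hc
      refine hr ⟨_, _, rfl, ?_, ?_⟩
      · exact by_contra fun h => hc (ih₁ hΓ (hΔ.tail.drop_refuted hn.pair_left h))
      · exact fun hv => by_contra fun h =>
          hc (ih₂ hΓ (hΔ.tail.drop_refuted (hn.pair_right hv) h))
  | binop _ _ ih₁ ih₂ =>
    intro Γ' Δ' hΓ hΔ
    rcases hΔ.head with he | ⟨-, hn, -⟩
    · rw [← he]
      exact .binop (ih₁ hΓ (hΔ.tail.insert_both _)) (ih₂ hΓ (hΔ.tail.insert_both _))
    · rcases hn.binop_cases with ⟨hc, h⟩ | ⟨hc, h⟩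
      · exact ih₁ hΓ (hΔ.tail.drop_refuted hc (not_holds_int h))
      · exact ih₂ hΓ (hΔ.tail.drop_refuted hc (not_holds_int h))
  | relop _ _ ih₁ ih₂ =>
    intro Γ' Δ' hΓ hΔ
    rcases hΔ.head with he | ⟨-, hn, -⟩
    · rw [← he]
      exact .relop (ih₁ hΓ (hΔ.tail.insert_both _)) (ih₂ hΓ (hΔ.tail.insert_both _))
    · rcases hn.relop_cases with ⟨hc, h⟩ | ⟨hc, h⟩
      · exact ih₁ hΓ (hΔ.tail.drop_refuted hc (not_holds_int h))
      · exact ih₂ hΓ (hΔ.tail.drop_refuted hc (not_holds_int h))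
  | app _ _ ih₁ ih₂ =>
    intro Γ' Δ' hΓ hΔ
    rcases hΔ.head with he | ⟨-, hn, -⟩
    · rw [← he]
      exact .app (ih₁ hΓ (hΔ.tail.insert_both _)) (ih₂ hΓ (hΔ.tail.insert_both _))
    -- The head is not an abstraction, so it fails every arrow type, whatever `A` and `B` are.
    · exact ih₁ hΓ (hΔ.tail.drop_refuted hn.app_left.1 hn.app_left.2)
  | fix _ ih =>
    intro Γ' Δ' hΓ hΔ
    rcases hΔ.head with he | ⟨-, hn, -⟩
    · rw [← he]
      exact .fix (ih (Finset.insert_subset_insert _ (Finset.image_subset_image hΓ))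
        ((hΔ.tail.shift 1).insert_both _))
    · exact hn.not_fix.elim
  | mtch θ hθ _ _ ih₁ ih₂ =>
    intro Γ' Δ' hΓ hΔ
    rcases hΔ.head with he | ⟨-, hn, -⟩
    · rw [← he]
      exact .mtch θ hθ (ih₁ hΓ (hΔ.tail.insert_both _)) fun i =>
        ih₂ i (Finset.union_subset_union_right (Finset.image_subset_image hΓ))
          (((hΔ.tail.shift _).insert_both _).insert_both _)
    · exact ih₁ hΓ (hΔ.tail.drop_refuted hn.mtch_scrutinee.1 (hn.not_holds_patterns hθ))
  | binopE _ ih =>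
    intro Γ' Δ' hΓ hΔ
    rcases hΔ.head with he | ⟨-, -, hr⟩
    · rw [← he]
      exact .binopE (ih hΓ ((hΔ.tail.insert_both _).insert_both _))
    -- Refuting the complement of `ok` would make the operation a value.
    · exact (hr id).elim
  | relopE _ ih =>
    intro Γ' Δ' hΓ hΔ
    rcases hΔ.head with he | ⟨-, -, hr⟩
    · rw [← he]
      exact .relopE (ih hΓ ((hΔ.tail.insert_both _).insert_both _))
    · exact (hr id).elim
  | pairE _ ih =>
    intro Γ' Δ' hΓ hΔ
    rcases hΔ.head with he | ⟨-, hn, hr⟩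
    · rw [← he]
      exact .pairE (ih hΓ ((hΔ.tail.insert_both _).insert_both _))
    -- The pair is a value, hence so are its components, and both active formulas of the premise are
    -- refuted together.
    · obtain ⟨h₁, h₂⟩ := not_not.1 hr
      exact ih hΓ ((hΔ.tail.drop_refuted (A := .compl .ok) (hn.pair_right h₁)
        fun h => h h₂).drop_refuted (A := .compl .ok) hn.pair_left fun h => h h₁)
  | appE _ ih =>
    intro Γ' Δ' hΓ hΔ
    rcases hΔ.head with he | ⟨-, -, hr⟩
    · rw [← he]
      exact .appE (ih hΓ (hΔ.tail.insert_both _))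
    · exact (hr id).elim
  | mtchE _ ih =>
    intro Γ' Δ' hΓ hΔ
    rcases hΔ.head with he | ⟨-, -, hr⟩
    · rw [← he]
      exact .mtchE (ih hΓ (hΔ.tail.insert_both _))
    · exact (hr id).elim

/-- In the two-sided system, derivability is preserved by weakening and by the removal of verified
formulas on the left and of refuted formulas on the right. -/
theorem TwoSided.remove_verified_refuted {Γ Δ : Finset (Formula S)} (h : TwoSided Γ Δ) :
    ∀ {Γ' Δ' : Finset (Formula S)}, UpToVerified Γ Γ' → UpToRefuted Δ Δ' →
      TwoSided Γ' Δ' := by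
  induction h with
  | var Γ Δ x A =>
    intro Γ' Δ' hΓ hΔ
    rcases hΔ.head with he | ⟨-, hn, -⟩
    · rcases hΓ.head with he' | ⟨-, hn, -⟩
      · rw [← he, ← he']
        exact .var Γ' Δ' x A
      · exact hn.not_var.elim
    · exact hn.not_var.elim
  | top Γ Δ M =>
    intro Γ' Δ' hΓ hΔ
    rcases hΔ.head with he | ⟨-, -, hr⟩
    · rw [← he]
      exact .top Γ' Δ' M
    · exact (hr trivial).elim
  | num Γ Δ n =>
    intro Γ' Δ' hΓ hΔ
    rcases hΔ.head with he | ⟨-, -, hr⟩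
    · rw [← he]
      exact .num Γ' Δ' n
    · exact (hr ⟨n, rfl⟩).elim
  | atom Γ Δ a =>
    intro Γ' Δ' hΓ hΔ
    rcases hΔ.head with he | ⟨-, -, hr⟩
    · rw [← he]
      exact .atom Γ' Δ' a
    · exact (hr rfl).elim
  | subL hs _ ih =>
    intro Γ' Δ' hΓ hΔ
    rcases hΓ.head with he | ⟨-, hn, hv⟩
    · rw [← he]
      exact .subL hs (ih (hΓ.tail.insert_both _) hΔ)
    · exact ih (hΓ.tail.drop_verified hn (hs.holds hv)) hΔ
  | subR hs _ ih =>
    intro Γ' Δ' hΓ hΔ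
    rcases hΔ.head with he | ⟨-, hn, hr⟩
    · rw [← he]
      exact .subR hs (ih hΓ (hΔ.tail.insert_both _))
    · exact ih hΓ (hΔ.tail.drop_refuted hn fun h => hr (hs.holds h))
  | compL _ ih =>
    intro Γ' Δ' hΓ hΔ
    rcases hΓ.head with he | ⟨-, hn, hv⟩
    · rw [← he]
      exact .compL (ih hΓ.tail (hΔ.insert_both _))
    -- A verified complement on the left becomes a refuted formula on the right; `compR` does the
    -- converse. Neither kind of removal could be proved without the other.
    · exact ih hΓ.tail (hΔ.drop_refuted hn hv)
  | compR _ ih =>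
    intro Γ' Δ' hΓ hΔ
    rcases hΔ.head with he | ⟨-, hn, hr⟩
    · rw [← he]
      exact .compR (ih (hΓ.insert_both _) hΔ.tail)
    · exact ih (hΓ.drop_verified hn (not_not.1 hr)) hΔ.tail
  | binop _ _ ih₁ ih₂ =>
    intro Γ' Δ' hΓ hΔ
    rcases hΔ.head with he | ⟨-, hn, -⟩
    · rw [← he]
      exact .binop (ih₁ hΓ (hΔ.tail.insert_both _)) (ih₂ hΓ (hΔ.tail.insert_both _))
    · rcases hn.binop_cases with ⟨hc, h⟩ | ⟨hc, h⟩
      · exact ih₁ hΓ (hΔ.tail.drop_refuted hc (not_holds_int h))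
      · exact ih₂ hΓ (hΔ.tail.drop_refuted hc (not_holds_int h))
  | relop _ _ ih₁ ih₂ =>
    intro Γ' Δ' hΓ hΔ
    rcases hΔ.head with he | ⟨-, hn, -⟩
    · rw [← he]
      exact .relop (ih₁ hΓ (hΔ.tail.insert_both _)) (ih₂ hΓ (hΔ.tail.insert_both _))
    · rcases hn.relop_cases with ⟨hc, h⟩ | ⟨hc, h⟩
      · exact ih₁ hΓ (hΔ.tail.drop_refuted hc (not_holds_int h))
      · exact ih₂ hΓ (hΔ.tail.drop_refuted hc (not_holds_int h))
  | fix _ ih =>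
    intro Γ' Δ' hΓ hΔ
    rcases hΔ.head with he | ⟨-, hn, -⟩
    · rw [← he]
      exact .fix (ih ((hΓ.shift 1).insert_both _) ((hΔ.tail.shift 1).insert_both _))
    · exact hn.not_fix.elim
  | pair _ _ ih₁ ih₂ =>
    intro Γ' Δ' hΓ hΔ
    rcases hΔ.head with he | ⟨-, hn, hr⟩
    · rw [← he]
      exact .pair (ih₁ hΓ (hΔ.tail.insert_both _)) (ih₂ hΓ (hΔ.tail.insert_both _))
    · by_contra hc
      refine hr ⟨_, _, rfl, ?_, ?_⟩
      · exact by_contra fun h => hc (ih₁ hΓ (hΔ.tail.drop_refuted hn.pair_left h))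
      · exact fun hv => by_contra fun h =>
          hc (ih₂ hΓ (hΔ.tail.drop_refuted (hn.pair_right hv) h))
  | abs _ ih =>
    intro Γ' Δ' hΓ hΔ
    rcases hΔ.head with he | ⟨-, -, hr⟩
    · rw [← he]
      exact .abs (ih ((hΓ.shift 1).insert_both _) ((hΔ.tail.shift 1).insert_both _))
    · exact (hr trivial).elim
  | app _ _ ih₁ ih₂ =>
    intro Γ' Δ' hΓ hΔ
    rcases hΔ.head with he | ⟨-, hn, -⟩
    · rw [← he]
      exact .app (ih₁ hΓ (hΔ.tail.insert_both _)) (ih₂ hΓ (hΔ.tail.insert_both _))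
    · exact ih₁ hΓ (hΔ.tail.drop_refuted hn.app_left.1 hn.app_left.2)
  | mtch θ hθ _ _ ih₁ ih₂ =>
    intro Γ' Δ' hΓ hΔ
    rcases hΔ.head with he | ⟨-, hn, -⟩
    · rw [← he]
      exact .mtch θ hθ (ih₁ hΓ (hΔ.tail.insert_both _)) fun i =>
        ih₂ i (((hΓ.shift _).union_left _).insert_both _) ((hΔ.tail.shift _).insert_both _)
    · exact ih₁ hΓ (hΔ.tail.drop_refuted hn.mtch_scrutinee.1 (hn.not_holds_patterns hθ))
  | binopE _ ih =>
    intro Γ' Δ' hΓ hΔ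
    rcases hΓ.head with he | ⟨-, -, hv⟩
    · rw [← he]
      exact .binopE (ih ((hΓ.tail.insert_both _).insert_both _) hΔ)
    · exact hv.elim
  | relopE _ ih =>
    intro Γ' Δ' hΓ hΔ
    rcases hΓ.head with he | ⟨-, -, hv⟩
    · rw [← he]
      exact .relopE (ih ((hΓ.tail.insert_both _).insert_both _) hΔ)
    · exact hv.elim
  | appE _ ih =>
    intro Γ' Δ' hΓ hΔ
    rcases hΓ.head with he | ⟨-, -, hv⟩
    · rw [← he]
      exact .appE (ih (hΓ.tail.insert_both _) hΔ)
    · exact hv.elim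
  | mtchE _ ih =>
    intro Γ' Δ' hΓ hΔ
    rcases hΓ.head with he | ⟨-, -, hv⟩
    · rw [← he]
      exact .mtchE (ih (hΓ.tail.insert_both _) hΔ)
    · exact hv.elim
  | pairE _ ih =>
    intro Γ' Δ' hΓ hΔ
    rcases hΓ.head with he | ⟨-, hn, hv⟩
    · rw [← he]
      exact .pairE (ih ((hΓ.tail.insert_both _).insert_both _) hΔ)
    -- Dual to the one-sided case: both components are values, so both premise formulas on the left
    -- are verified.
    · obtain ⟨h₁, h₂⟩ := hv
      exact ih ((hΓ.tail.drop_verified (A := .ok) (hn.pair_right h₁) h₂).drop_verified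
        (A := .ok) hn.pair_left h₁) hΔ

/-! ## Cut admissibility -/

/-- Excluded middle for `A` at `U` in the model decides which derivation to use: that of `B` if `A`
holds, and that of `A` otherwise. -/
theorem OneSided.cut {U : Term S} (hU : U.ClosedNormal) {A B : Ty} (hs : Sub A (.compl B))
    {Γ : Finset VarTyping} {Δ : Finset (Formula S)} (hA : OneSided Γ (insert (U, A) Δ))
    (hB : OneSided Γ (insert (U, B) Δ)) : OneSided Γ Δ := by
  by_cases h : A.Holds U
  · exact hB.remove_refuted subset_rfl ((SubsetUpTo.refl Δ).drop_refuted hU (hs.holds h))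
  · exact hA.remove_refuted subset_rfl ((SubsetUpTo.refl Δ).drop_refuted hU h)

theorem TwoSided.cut {U : Term S} (hU : U.ClosedNormal) {A B : Ty} (hs : Sub A (.compl B))
    {Γ Δ : Finset (Formula S)} (hA : TwoSided Γ (insert (U, A) Δ))
    (hB : TwoSided Γ (insert (U, B) Δ)) : TwoSided Γ Δ := by
  by_cases h : A.Holds U
  · exact hB.remove_verified_refuted (.refl Γ)
      ((SubsetUpTo.refl Δ).drop_refuted hU (hs.holds h))
  · exact hA.remove_verified_refuted (.refl Γ) ((SubsetUpTo.refl Δ).drop_refuted hU h)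

/-- This makes a cut on `A` and its complement an instance of the general cut. -/
theorem Sub.compl_compl (A : Ty) : Sub A (.compl (.compl A)) := .compR (.refl _)

/-- No rule of the one-sided system concludes a sequent with an empty right-hand side. -/
theorem OneSided.ne_empty {Γ : Finset VarTyping} {Δ : Finset (Formula S)} (h : OneSided Γ Δ) :
    Δ ≠ ∅ := by
  cases h <;> exact Finset.insert_ne_empty _ _

/-- No rule of the two-sided system concludes the empty sequent. -/
theorem TwoSided.ne_empty {Γ Δ : Finset (Formula S)} (h : TwoSided Γ Δ) : Γ ≠ ∅ ∨ Δ ≠ ∅ := by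
  cases h <;> first
    | exact Or.inl (Finset.insert_ne_empty _ _)
    | exact Or.inr (Finset.insert_ne_empty _ _)

end TwoSidedTyping

theorem mainTheorem3 (S : TwoSidedTyping.Signature) (U : TwoSidedTyping.Term S)
    (hclosed : U.Closed) (hnormal : TwoSidedTyping.NormalForm U) :
    -- the one-sided system
    ((∀ A B : TwoSidedTyping.Ty, TwoSidedTyping.Sub A (.compl B) →
        ∀ (Γ : Finset TwoSidedTyping.VarTyping) (Δ : Finset (TwoSidedTyping.Formula S)),
          TwoSidedTyping.OneSided Γ (insert (U, A) Δ) →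
          TwoSidedTyping.OneSided Γ (insert (U, B) Δ) →
          TwoSidedTyping.OneSided Γ Δ) ∧
      (∀ (A : TwoSidedTyping.Ty) (Γ : Finset TwoSidedTyping.VarTyping)
          (Δ : Finset (TwoSidedTyping.Formula S)),
          TwoSidedTyping.OneSided Γ (insert (U, A) Δ) →
          TwoSidedTyping.OneSided Γ (insert (U, .compl A) Δ) →
          TwoSidedTyping.OneSided Γ Δ) ∧
      (∀ A : TwoSidedTyping.Ty,
        ¬ (TwoSidedTyping.OneSided ∅ {(U, A)} ∧
          TwoSidedTyping.OneSided ∅ {(U, .compl A)}))) ∧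
    -- the two-sided system
    ((∀ A B : TwoSidedTyping.Ty, TwoSidedTyping.Sub A (.compl B) →
        ∀ Γ Δ : Finset (TwoSidedTyping.Formula S),
          TwoSidedTyping.TwoSided Γ (insert (U, A) Δ) →
          TwoSidedTyping.TwoSided Γ (insert (U, B) Δ) →
          TwoSidedTyping.TwoSided Γ Δ) ∧
      (∀ (A : TwoSidedTyping.Ty) (Γ Δ : Finset (TwoSidedTyping.Formula S)),
          TwoSidedTyping.TwoSided Γ (insert (U, A) Δ) →
          TwoSidedTyping.TwoSided Γ (insert (U, .compl A) Δ) →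
          TwoSidedTyping.TwoSided Γ Δ) ∧
      (∀ A : TwoSidedTyping.Ty,
        ¬ (TwoSidedTyping.TwoSided ∅ {(U, A)} ∧
          TwoSidedTyping.TwoSided ∅ {(U, .compl A)}))) := by
  have hU : U.ClosedNormal := ⟨hclosed, hnormal⟩
  refine ⟨⟨fun A B hs Γ Δ hA hB => hA.cut hU hs hB,
    fun A Γ Δ hA hB => hA.cut hU (.compl_compl A) hB, fun A h => ?_⟩,
    fun A B hs Γ Δ hA hB => hA.cut hU hs hB,
    fun A Γ Δ hA hB => hA.cut hU (.compl_compl A) hB, fun A h => ?_⟩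
  -- With singletons read as insertions into the empty set, the cut would derive the empty sequent,
  -- which no rule concludes.
  · rw [← insert_empty_eq (U, A), ← insert_empty_eq (U, A.compl)] at h
    exact (h.1.cut hU (.compl_compl A) h.2).ne_empty rfl
  · rw [← insert_empty_eq (U, A), ← insert_empty_eq (U, A.compl)] at h
    exact (h.1.cut hU (.compl_compl A) h.2).ne_empty.elim (· rfl) (· rfl)
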